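/- Let $\mathcal A$ be a complex Fréchet algebra, i.e. a (not necessarily unital or commutative) complete Hausdorff complex algebra whose topology is generated by an increasing sequence of submultiplicative seminorms. All duals carry the strong topology (uniform convergence on bounded sets), and "weak" refers to the weak topology $\sigma(E,E^*)$ of a locally convex space $E$. For a locally convex algebra $\mathcal B$ with separately continuous multiplication, $f\in\mathcal B^*$ and $a\in\mathcal B$, put $(a\cdot f)(b)=f(ba)$ and $(f\cdot a)(b)=f(ab)$ for $b\in\mathcal B$. Let $WAP(\mathcal B)$ be the space of all $f\in\mathcal B^*$ for which there is a zero neighbourhood $U$ in $\mathcal B$ such that the weak closure of $\{a\cdot f: a\in U\}$ is weakly compact in $\mathcal B^*$; call $\mathcal B$ Arens regular if $WAP(\mathcal B)=\mathcal B^*$. For $F,G\in\mathcal A^{**}$ and $f\in\mathcal A^*$ put $(F\cdot f)(a)=F(f\cdot a)$ and $(f\cdot F)(a)=F(a\cdot f)$ for $a\in\mathcal A$, and let $(F\,\square\, G)(f)=F(G\cdot f)$ and $(F\,\Diamond\, G)(f)=G(f\cdot F)$ be the two Arens products. Give $WAP(\mathcal A)$ the topology induced from $\mathcal A^*$; the same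 formulas, with $F,G\in WAP(\mathcal A)^*$ and $f\in WAP(\mathcal A)$, define the convolution product $(F*G)(f)=F(G\cdot f)$ and the evolution product $(F\circ G)(f)=G(f\cdot F)$ on $WAP(\mathcal A)^*$. Regard $WAP(\mathcal A)^{**}$ as a subspace of $\mathcal A^{***}$ through the (injective) transpose of the restriction map $\mathcal A^{**}\to WAP(\mathcal A)^*$. Then, when $\mathcal A^{**}$ carries the product $\square$ and $WAP(\mathcal A)^*$ the product $*$, the following are equivalent: (i) $\mathcal A^{**}$ is Arens regular; (ii) $\mathcal A$ and $WAP(\mathcal A)^*$ are Arens regular; (iii) $\mathcal A$ is Arens regular and $WAP(\mathcal A)^{**}=WAP(\mathcal A^{**})$ as subspaces of $\mathcal A^{***}$. The same equivalence holds when $\mathcal A^{**}$ carries the product $\Diamond$ and $WAP(\mathcal A)^*$ the product $\circ$. -/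

import Mathlib

open Topology Bornology Set

noncomputable section

set_option linter.unusedSectionVars false

namespace ArensReg

/-! ### Fréchet algebras -/

/-- A (not necessarily unital, not necessarily commutative) complex Fréchet algebra: a complete
Hausdorff algebra whose topology is generated by an increasing sequence of submultiplicative
seminorms. -/
class FrechetAlgebra (A : Type*) [NonUnitalRing A] [Module ℂ A] [IsScalarTower ℂ A A]
    [SMulCommClass ℂ A A] [UniformSpace A] : Prop
    extends IsUniformAddGroup A, CompleteSpace A, T2Space A where
  exists_seminorms : ∃ p : ℕ → Seminorm ℂ A, WithSeminorms p ∧ Monotone p ∧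
    ∀ n a b, p n (a * b) ≤ p n a * p n b

section Frechet

variable {A : Type*} [NonUnitalRing A] [Module ℂ A] [IsScalarTower ℂ A A]
  [SMulCommClass ℂ A A] [UniformSpace A] [FrechetAlgebra A]

instance FrechetAlgebra.toPolynormableSpace : PolynormableSpace ℂ A := by
  obtain ⟨p, hp, -, -⟩ := FrechetAlgebra.exists_seminorms (A := A)
  exact hp.toPolynormableSpace

instance FrechetAlgebra.toContinuousSMul : ContinuousSMul ℂ A := by
  obtain ⟨p, hp, -, -⟩ := FrechetAlgebra.exists_seminorms (A := A)
  exact hp.continuousSMul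

instance FrechetAlgebra.toContinuousMul : ContinuousMul A := by
  obtain ⟨p, hp, -, hmul⟩ := FrechetAlgebra.exists_seminorms (A := A)
  refine ⟨continuous_iff_continuousAt.2 fun ⟨a, b⟩ => ?_⟩
  refine (hp.tendsto_nhds _ _).2 fun i ε hε => ?_
  have hc := hp.continuous_seminorm i
  have h : Filter.Tendsto (fun x : A × A => p i (x.1 - a) * p i x.2 + p i a * p i (x.2 - b))
      (𝓝 (a, b)) (𝓝 0) := by
    have : Continuous (fun x : A × A => p i (x.1 - a) * p i x.2 + p i a * p i (x.2 - b)) := by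
      fun_prop
    simpa using this.tendsto (a, b)
  filter_upwards [h.eventually (gt_mem_nhds hε)] with x hx
  refine lt_of_le_of_lt ?_ hx
  have e : x.1 * x.2 - a * b = (x.1 - a) * x.2 + a * (x.2 - b) := by noncomm_ring
  simp only [e]
  exact (map_add_le_add (p i) _ _).trans (add_le_add (hmul _ _ _) (hmul _ _ _))

end Frechet

/-! ### Module actions on the dual and weakly almost periodic functionals

`StrongDual ℂ A` carries the strong topology (uniform convergence on bounded sets), and
`WeakSpace ℂ (StrongDual ℂ A)` is the same space with its weak topology `σ(A*, A**)`. -/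

section WAP

variable {A : Type*} [NonUnitalRing A] [Module ℂ A] [IsScalarTower ℂ A A]
  [SMulCommClass ℂ A A] [TopologicalSpace A] [SeparatelyContinuousMul A]

/-- `b ↦ a * b`. -/
def mulLeftL (a : A) : A →L[ℂ] A where
  toLinearMap := LinearMap.mulLeft ℂ a
  cont := continuous_const_mul a

/-- `b ↦ b * a`. -/
def mulRightL (a : A) : A →L[ℂ] A where
  toLinearMap := LinearMap.mulRight ℂ a
  cont := continuous_mul_const a

@[simp] lemma mulLeftL_apply (a b : A) : mulLeftL a b = a * b := rfl

@[simp] lemma mulRightL_apply (a b : A) : mulRightL a b = b * a := rfl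

/-- The left action `a · f` on the dual: `(a · f) b = f (b * a)`, continuous in `f`. -/
def dualL (a : A) : StrongDual ℂ A →L[ℂ] StrongDual ℂ A :=
  ContinuousLinearMap.precomp ℂ (mulRightL a)

/-- The right action `f · a` on the dual: `(f · a) b = f (a * b)`, continuous in `f`. -/
def dualR (a : A) : StrongDual ℂ A →L[ℂ] StrongDual ℂ A :=
  ContinuousLinearMap.precomp ℂ (mulLeftL a)

@[simp] lemma dualL_apply (a b : A) (f : StrongDual ℂ A) : dualL a f b = f (b * a) := rfl

@[simp] lemma dualR_apply (a b : A) (f : StrongDual ℂ A) : dualR a f b = f (a * b) := rfl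

/-- The set `{a · f : a ∈ U}`, as a subset of the dual with its weak topology. -/
def orbit (f : StrongDual ℂ A) (U : Set A) : Set (WeakSpace ℂ (StrongDual ℂ A)) :=
  (fun a => toWeakSpace ℂ (StrongDual ℂ A) (dualL a f)) '' U

/-- `f` is weakly almost periodic: the operator `a ↦ a · f` from `A` to `A*` is weakly compact,
i.e. the weak closure of `{a · f : a ∈ U}` is weakly compact for some zero neighbourhood `U`. -/
def IsWAP (f : StrongDual ℂ A) : Prop :=
  ∃ U ∈ 𝓝 (0 : A), IsCompact (closure (orbit f U))

lemma isWAP_of_subset {f : StrongDual ℂ A} {U : Set A} (hU : U ∈ 𝓝 (0 : A))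
    {K : Set (WeakSpace ℂ (StrongDual ℂ A))} (hK : IsCompact K) (h : orbit f U ⊆ K) : IsWAP f :=
  ⟨U, hU, hK.closure_of_subset h⟩

lemma IsWAP.map {f g : StrongDual ℂ A} (hf : IsWAP f)
    (T : StrongDual ℂ A →L[ℂ] StrongDual ℂ A) (h : ∀ a, dualL a g = T (dualL a f)) : IsWAP g := by
  obtain ⟨U, hU, hc⟩ := hf
  refine isWAP_of_subset hU (hc.image (WeakSpace.map T).continuous) ?_
  rintro _ ⟨a, ha, rfl⟩
  exact ⟨_, subset_closure ⟨a, ha, rfl⟩, (h a).symm⟩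

variable (A) in
/-- The space `WAP(A)` of weakly almost periodic functionals. -/
def WAP : Submodule ℂ (StrongDual ℂ A) where
  carrier := {f | IsWAP f}
  zero_mem' := by
    refine isWAP_of_subset Filter.univ_mem (isCompact_singleton (x := 0)) ?_
    rintro _ ⟨a, -, rfl⟩
    exact (congrArg _ (map_zero (dualL a))).trans (map_zero _)
  add_mem' := by
    rintro f g ⟨U, hU, hf⟩ ⟨V, hV, hg⟩
    refine isWAP_of_subset (Filter.inter_mem hU hV) (hf.add hg) ?_
    rintro _ ⟨a, ⟨haU, haV⟩, rfl⟩
    exact ⟨_, subset_closure ⟨a, haU, rfl⟩, _, subset_closure ⟨a, haV, rfl⟩,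
      ((congrArg _ (map_add (dualL a) f g)).trans (map_add _ _ _)).symm⟩
  smul_mem' := fun c f hf => hf.map (c • ContinuousLinearMap.id ℂ _) fun a => by simp

lemma mem_WAP {f : StrongDual ℂ A} : f ∈ WAP A ↔ IsWAP f := Iff.rfl

variable (A) in
/-- The topological algebra `A` is Arens regular: `WAP(A) = A*`. -/
def ArensRegular : Prop := WAP A = ⊤

lemma isWAP_dualR {f : StrongDual ℂ A} (hf : IsWAP f) (a : A) : IsWAP (dualR a f) :=
  hf.map (dualR a) fun b => by ext c; simp [mul_assoc]

lemma isWAP_dualL {f : StrongDual ℂ A} (hf : IsWAP f) (a : A) : IsWAP (dualL a f) := by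
  obtain ⟨U, hU, hc⟩ := hf
  refine isWAP_of_subset (U := (· * a) ⁻¹' U)
    ((continuous_mul_const a).continuousAt.preimage_mem_nhds (by simpa using hU)) hc ?_
  rintro _ ⟨b, hb, rfl⟩
  refine subset_closure ⟨b * a, hb, congrArg (toWeakSpace ℂ (StrongDual ℂ A)) ?_⟩
  ext c
  simp [mul_assoc]

variable (A) in
/-- `WAP(A)` as a topological vector space, with the topology induced from the strong dual. -/
def WAPSpace : Type _ := WAP A

instance : AddCommGroup (WAPSpace A) := inferInstanceAs (AddCommGroup (WAP A))

instance : Module ℂ (WAPSpace A) := inferInstanceAs (Module ℂ (WAP A))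

instance : TopologicalSpace (WAPSpace A) := inferInstanceAs (TopologicalSpace (WAP A))

variable (A) in
/-- The inclusion of `WAP(A)` into the strong dual. -/
def wapIncl : WAPSpace A →L[ℂ] StrongDual ℂ A where
  toFun f := (show WAP A from f).1
  map_add' _ _ := rfl
  map_smul' _ _ := rfl
  cont := continuous_subtype_val

lemma isInducing_wapIncl : IsInducing (wapIncl A) := IsInducing.subtypeVal

lemma wapIncl_injective : Function.Injective (wapIncl A) := Subtype.val_injective

instance : IsTopologicalAddGroup (WAPSpace A) :=
  topologicalAddGroup_induced (wapIncl A).toLinearMap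

instance : ContinuousSMul ℂ (WAPSpace A) :=
  isInducing_wapIncl.continuousSMul continuous_id (map_smul (wapIncl A) _ _)

lemma wapIncl_mem (f : WAPSpace A) : IsWAP (wapIncl A f) := Subtype.property (p := IsWAP) f

/-- A weakly almost periodic functional as an element of `WAPSpace A`. -/
def WAPSpace.mk (f : StrongDual ℂ A) (hf : IsWAP f) : WAPSpace A := (⟨f, hf⟩ : WAP A)

@[simp] lemma wapIncl_mk (f : StrongDual ℂ A) (hf : IsWAP f) :
    wapIncl A (WAPSpace.mk f hf) = f := rfl

/-- The right action `f ↦ f · a` on `WAP(A)`. -/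
def wapR (a : A) (f : WAPSpace A) : WAPSpace A :=
  WAPSpace.mk (dualR a (wapIncl A f)) (isWAP_dualR (wapIncl_mem f) a)

/-- The left action `f ↦ a · f` on `WAP(A)`. -/
def wapL (a : A) (f : WAPSpace A) : WAPSpace A :=
  WAPSpace.mk (dualL a (wapIncl A f)) (isWAP_dualL (wapIncl_mem f) a)

@[simp] lemma wapIncl_wapR (a : A) (f : WAPSpace A) :
    wapIncl A (wapR a f) = dualR a (wapIncl A f) := rfl

@[simp] lemma wapIncl_wapL (a : A) (f : WAPSpace A) :
    wapIncl A (wapL a f) = dualL a (wapIncl A f) := rfl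

end WAP

/-! ### Continuity facts for jointly continuous multiplications -/

section Cont

variable {A : Type*} [NonUnitalRing A] [Module ℂ A] [IsScalarTower ℂ A A]
  [SMulCommClass ℂ A A] [TopologicalSpace A] [IsTopologicalAddGroup A] [ContinuousSMul ℂ A]
  [ContinuousMul A]

/-- `a ↦ (b ↦ a * b)` as a continuous linear map. -/
def mulLL : A →L[ℂ] (A →L[ℂ] A) :=
  let m : A →ₗ[ℂ] (A →L[ℂ] A) :=
    { toFun := mulLeftL
      map_add' := fun x y => by ext; simp [add_mul]
      map_smul' := fun c x => by ext; simp [smul_mul_assoc] }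
  ⟨m, ContinuousLinearMap.continuous_of_continuous_uncurry m
      (by exact (continuous_mul : Continuous fun p : A × A => p.1 * p.2))⟩

lemma isVonNBounded_mul {B C : Set A} (hB : IsVonNBounded ℂ B) (hC : IsVonNBounded ℂ C) :
    IsVonNBounded ℂ (image2 (fun b c => b * c) B C) := by
  have h := ContinuousLinearMap.isVonNBounded_image2_apply (hB.image (mulLL (A := A))) hC
  rwa [image2_image_left] at h

/-- `a ↦ f · a` and `a ↦ a · f` are continuous from `A` to the strong dual. -/
lemma continuous_dualR (f : StrongDual ℂ A) : Continuous fun a => dualR a f := by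
  let m : A →ₗ[ℂ] StrongDual ℂ A :=
    { toFun := fun a => dualR a f
      map_add' := fun x y => by ext; simp [add_mul]
      map_smul' := fun c x => by ext; simp [smul_mul_assoc] }
  exact ContinuousLinearMap.continuous_of_continuous_uncurry m
    (by exact f.continuous.comp (continuous_mul : Continuous fun p : A × A => p.1 * p.2))

lemma continuous_dualL (f : StrongDual ℂ A) : Continuous fun a => dualL a f := by
  let m : A →ₗ[ℂ] StrongDual ℂ A :=
    { toFun := fun a => dualL a f
      map_add' := fun x y => by ext; simp [mul_add]
      map_smul' := fun c x => by ext; simp [mul_smul_comm] }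
  exact ContinuousLinearMap.continuous_of_continuous_uncurry m
    (by exact f.continuous.comp (by fun_prop : Continuous fun p : A × A => p.2 * p.1))

/-- Neighbourhoods of zero in a space whose topology is induced from the strong dual. -/
lemma exists_of_mem_nhds {X : Type*} [AddCommGroup X] [Module ℂ X] [TopologicalSpace X]
    {e : X →L[ℂ] StrongDual ℂ A} (he : IsInducing e) {W : Set X} (hW : W ∈ 𝓝 (0 : X)) :
    ∃ B : Set A, IsVonNBounded ℂ B ∧ ∃ V ∈ 𝓝 (0 : ℂ), ∀ x, (∀ b ∈ B, e x b ∈ V) → x ∈ W := by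
  rw [he.nhds_eq_comap, map_zero, Filter.mem_comap] at hW
  obtain ⟨t, ht, hs⟩ := hW
  obtain ⟨⟨B, V⟩, ⟨hB, hV⟩, h⟩ := ContinuousLinearMap.hasBasis_nhds_zero.mem_iff.1 ht
  exact ⟨B, hB, V, hV, fun x hx => hs (h hx)⟩

section Generic

/- Here `X ⊆ A*` is a subspace with the induced topology, `r a x` is one of the two actions of `A`
on `X`, and `m` is the multiplication of `A` or its opposite. -/
variable {X : Type*} [AddCommGroup X] [Module ℂ X] [TopologicalSpace X] [IsTopologicalAddGroup X]
  (e : X →L[ℂ] StrongDual ℂ A)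

/-- For `G ∈ X*`, the map `x ↦ (a ↦ G (r a x))` is continuous for the strong topologies. -/
lemma continuous_slice
    (he : IsInducing e) (m : A → A → A)
    (hm : ∀ B C, IsVonNBounded ℂ B → IsVonNBounded ℂ C → IsVonNBounded ℂ (image2 m B C))
    (r : A → X → X) (hr : ∀ a x b, e (r a x) b = e x (m a b))
    (G : StrongDual ℂ X)
    (L : X →ₗ[ℂ] StrongDual ℂ A) (hL : ∀ x a, L x a = G (r a x)) : Continuous L := by
  refine continuous_of_continuousAt_zero L ?_
  rw [ContinuousAt, map_zero]
  refine ContinuousLinearMap.hasBasis_nhds_zero.tendsto_right_iff.2 ?_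
  rintro ⟨B, U⟩ ⟨hB, hU⟩
  have hG : G ⁻¹' U ∈ 𝓝 (0 : X) := G.continuous.continuousAt.preimage_mem_nhds (by simpa using hU)
  obtain ⟨C, hC, V, hV, h⟩ := exists_of_mem_nhds he hG
  have hev : ∀ᶠ g : StrongDual ℂ A in 𝓝 0, MapsTo g (image2 m B C) V :=
    ContinuousLinearMap.eventually_nhds_zero_mapsTo (hm B C hB hC) hV
  have he0 : Filter.Tendsto e (𝓝 0) (𝓝 0) := by simpa using e.continuous.tendsto 0
  filter_upwards [he0.eventually hev] with x hx b hb
  rw [hL]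
  refine h _ fun c hc => ?_
  rw [hr]
  exact hx ⟨b, hb, c, hc, rfl⟩

/-- The set of all `r b x` with `b`, `x` ranging over bounded sets is bounded. -/
lemma isVonNBounded_action
    (he : IsInducing e) (m : A → A → A)
    (hm : ∀ B C, IsVonNBounded ℂ B → IsVonNBounded ℂ C → IsVonNBounded ℂ (image2 m B C))
    (r : A → X → X) (hr : ∀ a x b, e (r a x) b = e x (m a b))
    {B : Set A} {C : Set X} (hB : IsVonNBounded ℂ B)
    (hC : IsVonNBounded ℂ C) : IsVonNBounded ℂ (image2 r B C) := by
  have h1 : IsVonNBounded ℂ (e '' image2 r B C) := by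
    refine ContinuousLinearMap.isVonNBounded_iff.2 fun s hs => ?_
    refine (ContinuousLinearMap.isVonNBounded_image2_apply (hC.image e) (hm B s hB hs)).subset ?_
    rintro _ ⟨_, ⟨_, ⟨b, hb, x, hx, rfl⟩, rfl⟩, c, hc, rfl⟩
    exact ⟨e x, ⟨x, hx, rfl⟩, m b c, ⟨b, hb, c, hc, rfl⟩, (hr b x c).symm⟩
  intro W hW
  rw [he.nhds_eq_comap, map_zero, Filter.mem_comap] at hW
  obtain ⟨t, ht, hs⟩ := hW
  filter_upwards [h1 ht, Bornology.eventually_ne_cobounded (0 : ℂ)] with c hc hc0 x hx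
  rw [mem_smul_set_iff_inv_smul_mem₀ hc0]
  refine hs ?_
  have := hc ⟨x, hx, rfl⟩
  rw [mem_smul_set_iff_inv_smul_mem₀ hc0] at this
  simpa using this

/-- For fixed `F ∈ X*`, the map `G ↦ (x ↦ F (a ↦ G (r a x)))` is continuous on `X*`. -/
lemma continuous_prod
    (he : IsInducing e) (m : A → A → A)
    (hm : ∀ B C, IsVonNBounded ℂ B → IsVonNBounded ℂ C → IsVonNBounded ℂ (image2 m B C))
    (r : A → X → X) (hr : ∀ a x b, e (r a x) b = e x (m a b))
    (F : StrongDual ℂ X) (z : StrongDual ℂ X → X → X)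
    (hz : ∀ G x a, e (z G x) a = G (r a x)) (T : StrongDual ℂ X →ₗ[ℂ] StrongDual ℂ X)
    (hT : ∀ G x, T G x = F (z G x)) : Continuous T := by
  refine continuous_of_continuousAt_zero T ?_
  rw [ContinuousAt, map_zero]
  refine ContinuousLinearMap.hasBasis_nhds_zero.tendsto_right_iff.2 ?_
  rintro ⟨C, U⟩ ⟨hC, hU⟩
  have hF : F ⁻¹' U ∈ 𝓝 (0 : X) := F.continuous.continuousAt.preimage_mem_nhds (by simpa using hU)
  obtain ⟨B, hB, V, hV, h⟩ := exists_of_mem_nhds he hF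
  filter_upwards [ContinuousLinearMap.eventually_nhds_zero_mapsTo
    (isVonNBounded_action e he m hm r hr hB hC) hV] with G hG x hx
  rw [hT]
  refine h _ fun b hb => ?_
  rw [hz]
  exact hG ⟨b, hb, x, hx, rfl⟩

end Generic

lemma isVonNBounded_mul_swap {B C : Set A} (hB : IsVonNBounded ℂ B) (hC : IsVonNBounded ℂ C) :
    IsVonNBounded ℂ (image2 (fun b c => c * b) B C) := by
  rw [image2_swap]
  exact isVonNBounded_mul hC hB

end Cont

/-! ### The bidual with its two Arens products -/

section Bidual

variable {A : Type*} [NonUnitalRing A] [Module ℂ A] [IsScalarTower ℂ A A]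
  [SMulCommClass ℂ A A] [TopologicalSpace A] [IsTopologicalAddGroup A] [ContinuousSMul ℂ A]
  [ContinuousMul A]

/-- `f ↦ F · f`, where `(F · f) a = F (f · a)` for `F ∈ A**` and `f ∈ A*`. -/
def bidualLLin (F : StrongDual ℂ (StrongDual ℂ A)) : StrongDual ℂ A →ₗ[ℂ] StrongDual ℂ A where
  toFun f :=
    { toFun := fun a => F (dualR a f)
      map_add' := fun a b => by
        rw [← map_add]; congr 1; ext c; simp [add_mul]
      map_smul' := fun t a => by
        rw [RingHom.id_apply, ← map_smul]; congr 1; ext c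
        simp [smul_mul_assoc]
      cont := F.continuous.comp (continuous_dualR f) }
  map_add' f g := by ext a; simp
  map_smul' t f := by ext a; simp

/-- `bidualLLin F` as a continuous linear map. -/
def bidualL (F : StrongDual ℂ (StrongDual ℂ A)) : StrongDual ℂ A →L[ℂ] StrongDual ℂ A where
  toLinearMap := bidualLLin F
  cont := continuous_slice (ContinuousLinearMap.id ℂ _) IsInducing.id (fun a b => a * b)
    (fun _ _ => isVonNBounded_mul) (fun a f => dualR a f) (fun _ _ _ => rfl) F
    (bidualLLin F) fun _ _ => rfl

/-- `f ↦ f · F`, where `(f · F) a = F (a · f)` for `F ∈ A**` and `f ∈ A*`. -/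
def bidualRLin (F : StrongDual ℂ (StrongDual ℂ A)) : StrongDual ℂ A →ₗ[ℂ] StrongDual ℂ A where
  toFun f :=
    { toFun := fun a => F (dualL a f)
      map_add' := fun a b => by
        rw [← map_add]; congr 1; ext c; simp [mul_add]
      map_smul' := fun t a => by
        rw [RingHom.id_apply, ← map_smul]; congr 1; ext c
        simp [mul_smul_comm]
      cont := F.continuous.comp (continuous_dualL f) }
  map_add' f g := by ext a; simp
  map_smul' t f := by ext a; simp

/-- `bidualRLin F` as a continuous linear map. -/
def bidualR (F : StrongDual ℂ (StrongDual ℂ A)) : StrongDual ℂ A →L[ℂ] StrongDual ℂ A where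
  toLinearMap := bidualRLin F
  cont := continuous_slice (ContinuousLinearMap.id ℂ _) IsInducing.id (fun a b => b * a)
    (fun _ _ => isVonNBounded_mul_swap) (fun a f => dualL a f) (fun _ _ _ => rfl) F
    (bidualRLin F) fun _ _ => rfl

@[simp] lemma bidualL_apply (F : StrongDual ℂ (StrongDual ℂ A)) (f : StrongDual ℂ A) (a : A) :
    bidualL F f a = F (dualR a f) := rfl

@[simp] lemma bidualR_apply (F : StrongDual ℂ (StrongDual ℂ A)) (f : StrongDual ℂ A) (a : A) :
    bidualR F f a = F (dualL a f) := rfl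

/-- `F □ G`, where `(F □ G) f = F (G · f)`. -/
def box (F G : StrongDual ℂ (StrongDual ℂ A)) : StrongDual ℂ (StrongDual ℂ A) :=
  F.comp (bidualL G)

/-- `F ◇ G`, where `(F ◇ G) f = G (f · F)`. -/
def diamond (F G : StrongDual ℂ (StrongDual ℂ A)) : StrongDual ℂ (StrongDual ℂ A) :=
  G.comp (bidualR F)

@[simp] lemma box_apply (F G : StrongDual ℂ (StrongDual ℂ A)) (f : StrongDual ℂ A) :
    box F G f = F (bidualL G f) := rfl

@[simp] lemma diamond_apply (F G : StrongDual ℂ (StrongDual ℂ A)) (f : StrongDual ℂ A) :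
    diamond F G f = G (bidualR F f) := rfl

end Bidual

section BidualAlgebra

variable (A : Type*) [NonUnitalRing A] [Module ℂ A] [IsScalarTower ℂ A A]
  [SMulCommClass ℂ A A] [TopologicalSpace A] [IsTopologicalAddGroup A] [ContinuousSMul ℂ A]
  [ContinuousMul A]

/-- The bidual `A**` (strong topology), as an algebra under the first Arens product `□`. -/
def BidualBox : Type _ := StrongDual ℂ (StrongDual ℂ A)

/-- The bidual `A**` (strong topology), as an algebra under the second Arens product `◇`. -/
def BidualDiamond : Type _ := StrongDual ℂ (StrongDual ℂ A)

instance : AddCommGroup (BidualBox A) :=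
  inferInstanceAs (AddCommGroup (StrongDual ℂ (StrongDual ℂ A)))

instance : Module ℂ (BidualBox A) :=
  inferInstanceAs (Module ℂ (StrongDual ℂ (StrongDual ℂ A)))

instance : TopologicalSpace (BidualBox A) :=
  inferInstanceAs (TopologicalSpace (StrongDual ℂ (StrongDual ℂ A)))

instance : AddCommGroup (BidualDiamond A) :=
  inferInstanceAs (AddCommGroup (StrongDual ℂ (StrongDual ℂ A)))

instance : Module ℂ (BidualDiamond A) :=
  inferInstanceAs (Module ℂ (StrongDual ℂ (StrongDual ℂ A)))

instance : TopologicalSpace (BidualDiamond A) :=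
  inferInstanceAs (TopologicalSpace (StrongDual ℂ (StrongDual ℂ A)))

variable {A}

lemma box_add (F G H : StrongDual ℂ (StrongDual ℂ A)) : box F (G + H) = box F G + box F H := by
  ext f
  have : bidualL (G + H) f = bidualL G f + bidualL H f := rfl
  simp [this]

lemma box_smul (c : ℂ) (F G : StrongDual ℂ (StrongDual ℂ A)) : box F (c • G) = c • box F G := by
  ext f
  have : bidualL (c • G) f = c • bidualL G f := rfl
  simp [this]

lemma diamond_add_left (F G H : StrongDual ℂ (StrongDual ℂ A)) :
    diamond (F + G) H = diamond F H + diamond G H := by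
  ext f
  have : bidualR (F + G) f = bidualR F f + bidualR G f := rfl
  simp [this]

lemma diamond_smul_left (c : ℂ) (F G : StrongDual ℂ (StrongDual ℂ A)) :
    diamond (c • F) G = c • diamond F G := by
  ext f
  have : bidualR (c • F) f = c • bidualR F f := rfl
  simp [this]

lemma box_zero (F : StrongDual ℂ (StrongDual ℂ A)) : box F 0 = 0 := by
  ext f
  have : bidualL 0 f = 0 := rfl
  simp [this]

lemma zero_diamond (F : StrongDual ℂ (StrongDual ℂ A)) : diamond 0 F = 0 := by
  ext f
  have : bidualR 0 f = 0 := rfl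
  simp [this]

lemma box_assoc (F G H : StrongDual ℂ (StrongDual ℂ A)) : box (box F G) H = box F (box G H) := by
  ext f
  refine congrArg F ?_
  ext a
  refine congrArg G ?_
  ext b
  refine congrArg H ?_
  ext c
  simp [mul_assoc]

lemma diamond_assoc (F G H : StrongDual ℂ (StrongDual ℂ A)) :
    diamond (diamond F G) H = diamond F (diamond G H) := by
  ext f
  refine congrArg H ?_
  ext a
  refine congrArg G ?_
  ext b
  refine congrArg F ?_
  ext c
  simp [mul_assoc]

instance : NonUnitalRing (BidualBox A) :=
  { (inferInstance : AddCommGroup (BidualBox A)) with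
    mul := box (A := A)
    left_distrib := box_add (A := A)
    right_distrib := fun _ _ _ => rfl
    zero_mul := fun _ => rfl
    mul_zero := box_zero (A := A)
    mul_assoc := box_assoc (A := A) }

instance : NonUnitalRing (BidualDiamond A) :=
  { (inferInstance : AddCommGroup (BidualDiamond A)) with
    mul := diamond (A := A)
    left_distrib := fun _ _ _ => rfl
    right_distrib := diamond_add_left (A := A)
    zero_mul := zero_diamond (A := A)
    mul_zero := fun _ => rfl
    mul_assoc := diamond_assoc (A := A) }

instance : IsScalarTower ℂ (BidualBox A) (BidualBox A) := ⟨fun _ _ _ => rfl⟩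

instance : SMulCommClass ℂ (BidualBox A) (BidualBox A) := ⟨fun c F G => (box_smul c F G).symm⟩

instance : IsScalarTower ℂ (BidualDiamond A) (BidualDiamond A) :=
  ⟨fun c F G => diamond_smul_left c F G⟩

instance : SMulCommClass ℂ (BidualDiamond A) (BidualDiamond A) := ⟨fun _ _ _ => rfl⟩

instance : SeparatelyContinuousMul (BidualBox A) where
  continuous_const_mul {F} :=
    continuous_prod (ContinuousLinearMap.id ℂ (StrongDual ℂ A)) IsInducing.id (fun a b => a * b)
      (fun _ _ => isVonNBounded_mul) (fun a f => dualR a f) (fun _ _ _ => rfl) F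
      (fun G f => bidualL G f) (fun _ _ _ => rfl)
      { toFun := box F, map_add' := box_add F, map_smul' := fun c G => box_smul c F G }
      fun _ _ => rfl
  continuous_mul_const {G} := (ContinuousLinearMap.precomp ℂ (bidualL G)).continuous

instance : SeparatelyContinuousMul (BidualDiamond A) where
  continuous_const_mul {F} := (ContinuousLinearMap.precomp ℂ (bidualR F)).continuous
  continuous_mul_const {G} :=
    continuous_prod (ContinuousLinearMap.id ℂ (StrongDual ℂ A)) IsInducing.id (fun a b => b * a)
      (fun _ _ => isVonNBounded_mul_swap) (fun a f => dualL a f) (fun _ _ _ => rfl) G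
      (fun F f => bidualR F f) (fun _ _ _ => rfl)
      { toFun := fun F => diamond F G
        map_add' := fun F H => diamond_add_left F H G
        map_smul' := fun c F => diamond_smul_left c F G }
      fun _ _ => rfl

end BidualAlgebra

/-! ### `WAP(A)` is stable under the actions of `WAP(A)*` -/

section Introverted

variable {A : Type*} [NonUnitalRing A] [Module ℂ A] [IsScalarTower ℂ A A]
  [SMulCommClass ℂ A A] [TopologicalSpace A] [IsTopologicalAddGroup A] [ContinuousSMul ℂ A]
  [ContinuousMul A]

open scoped ComplexOrder in
instance : PolynormableSpace ℂ (StrongDual ℂ A) := by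
  have : LocallyConvexSpace ℂ ℂ :=
    LocallyConvexSpace.ofBasisZero ℂ ℂ _ _ Metric.nhds_basis_ball fun r _ =>
      convex_of_nonneg_surjective_algebraMap ℂ
        (fun _ h => RCLike.nonneg_iff_exists_ofReal.mp h) (convex_ball (0 : ℂ) r)
  have : ContinuousSMul ℝ (StrongDual ℂ A) := IsScalarTower.continuousSMul (M := ℝ) ℂ
  exact LocallyConvexSpace.toPolynormableSpace

lemma exists_extension (F : StrongDual ℂ (WAPSpace A)) :
    ∃ G : StrongDual ℂ (StrongDual ℂ A), ∀ f, G (wapIncl A f) = F f :=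
  StrongDual.exists_extension (WAP A) F

lemma isWAP_bidualR {f : StrongDual ℂ A} (hf : IsWAP f) (F : StrongDual ℂ (StrongDual ℂ A)) :
    IsWAP (bidualR F f) :=
  hf.map (bidualR F) fun a => by
    ext b
    refine congrArg F ?_
    ext c
    simp [mul_assoc]

/-- A functional lying in the bipolar of a balanced convex set with weakly compact weak closure
lies in that closure. -/
lemma mem_closure_of_bipolar {E : Type*} [AddCommGroup E] [Module ℂ E] [TopologicalSpace E]
    [IsTopologicalAddGroup E] [ContinuousSMul ℂ E] {S : Set (StrongDual ℂ E)}
    (hconv : Convex ℝ S) (hbal : Balanced ℂ S) (hne : S.Nonempty)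
    (hS : IsCompact (closure (toWeakSpace ℂ (StrongDual ℂ E) '' S))) {g : StrongDual ℂ E}
    (hg : ∀ x, (∀ h ∈ S, ‖h x‖ ≤ 1) → ‖g x‖ ≤ 1) :
    toWeakSpace ℂ (StrongDual ℂ E) g ∈ closure (toWeakSpace ℂ (StrongDual ℂ E) '' S) := by
  obtain ⟨h0, hh0⟩ := hne
  have hzero : (0 : StrongDual ℂ E) ∈ S := by
    have := hbal 0 (by simp) ⟨h0, hh0, rfl⟩
    have h0' : (0 : ℂ) • h0 = 0 := by ext; simp
    exact h0' ▸ this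
  rw [← Convex.toWeakSpace_closure (𝕜 := ℂ) hconv] at hS ⊢
  let ι : WeakSpace ℂ (StrongDual ℂ E) → WeakBilin (topDualPairing ℂ E) :=
    fun g => (toWeakSpace ℂ (StrongDual ℂ E)).symm g
  have hι : Continuous ι := by
    refine WeakBilin.continuous_of_continuous_eval _ fun x => ?_
    exact WeakBilin.eval_continuous (topDualPairing ℂ (StrongDual ℂ E)).flip
      { toFun := fun f : StrongDual ℂ E => f x
        map_add' := fun _ _ => rfl
        map_smul' := fun _ _ => rfl
        cont := continuous_eval_const x }
  have : T2Space (WeakBilin (topDualPairing ℂ E)) := inferInstanceAs (T2Space (WeakDual ℂ E))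
  have hcl : IsClosed (ι '' (toWeakSpace ℂ (StrongDual ℂ E) '' closure S)) :=
    (hS.image hι).isClosed
  rw [image_image] at hcl
  have hcv : Convex ℝ ((fun g : StrongDual ℂ E => ι (toWeakSpace ℂ (StrongDual ℂ E) g)) ''
      closure S) :=
    (hconv.closure.is_linear_image (f := fun g : StrongDual ℂ E =>
      ι (toWeakSpace ℂ (StrongDual ℂ E) g)) ⟨fun _ _ => rfl, fun _ _ => rfl⟩)
  refine ⟨g, ?_, rfl⟩
  by_contra hgS
  obtain ⟨φ, u, hφ, hu⟩ := RCLike.geometric_hahn_banach_closed_point (𝕜 := ℂ)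
    (x := ι (toWeakSpace ℂ (StrongDual ℂ E) g)) hcv hcl (by
      rintro ⟨g', hg', h⟩
      exact hgS ((show g' = g from h) ▸ hg'))
  obtain ⟨x, rfl⟩ := LinearMap.dualEmbedding_surjective (topDualPairing ℂ E) φ
  have hφ' : ∀ h ∈ S, (h x).re < u := fun h hh => hφ _ ⟨h, subset_closure hh, rfl⟩
  have hu' : u < (g x).re := hu
  have hu0 : 0 < u := by simpa using hφ' 0 hzero
  have hnorm : ∀ h ∈ S, ‖h x‖ ≤ u := by
    intro h hh
    by_cases h0 : h x = 0
    · rw [h0, norm_zero]; exact hu0.le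
    have hc := hφ' ((starRingEnd ℂ (h x) / ‖h x‖) • h)
      (hbal _ (by simp [h0]) ⟨h, hh, rfl⟩)
    have e : (((starRingEnd ℂ (h x) / ‖h x‖) • h) x).re = ‖h x‖ := by
      have : ((starRingEnd ℂ (h x) / ‖h x‖) • h) x = ((‖h x‖ : ℝ) : ℂ) := by
        have hn : ((‖h x‖ : ℝ) : ℂ) ≠ 0 := by simpa using h0
        rw [smul_apply, smul_eq_mul, div_mul_eq_mul_div, Complex.conj_mul',
          div_eq_iff hn, sq]
      rw [this, Complex.ofReal_re]
    rw [e] at hc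
    exact hc.le
  have hx := hg (((u⁻¹ : ℝ) : ℂ) • x) fun h hh => by
    rw [map_smul, norm_smul, Complex.norm_real, Real.norm_of_nonneg (inv_nonneg.2 hu0.le),
      inv_mul_le_iff₀ hu0, mul_one]
    exact hnorm h hh
  rw [map_smul, norm_smul, Complex.norm_real, Real.norm_of_nonneg (inv_nonneg.2 hu0.le),
      inv_mul_le_iff₀ hu0, mul_one] at hx
  exact absurd (hu'.trans_le ((Complex.re_le_norm _).trans hx)) (lt_irrefl _)

lemma isWAP_bidualL [PolynormableSpace ℂ A] {f : StrongDual ℂ A} (hf : IsWAP f)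
    (F : StrongDual ℂ (StrongDual ℂ A)) : IsWAP (bidualL F f) := by
  obtain ⟨U, hU, hc⟩ := hf
  obtain ⟨⟨s, r⟩, hr, hsU⟩ := (PolynormableSpace.withSeminorms ℂ A).hasBasis_zero_ball.mem_iff.1 hU
  set p : Seminorm ℂ A := s.sup (fun q => q.1) with hp
  have hball : p.ball 0 r ∈ 𝓝 (0 : A) :=
    (PolynormableSpace.withSeminorms ℂ A).hasBasis_zero_ball.mem_of_mem (i := (s, r)) hr
  let Φ : A →ₗ[ℂ] StrongDual ℂ A :=
    { toFun := fun a => dualL a f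
      map_add' := fun x y => by ext; simp [mul_add]
      map_smul' := fun c x => by ext; simp [mul_smul_comm] }
  have hK : IsCompact (closure (toWeakSpace ℂ (StrongDual ℂ A) '' (Φ '' p.ball 0 r))) := by
    refine hc.of_isClosed_subset isClosed_closure (closure_mono ?_)
    rintro _ ⟨_, ⟨a, ha, rfl⟩, rfl⟩
    exact ⟨a, hsU ha, rfl⟩
  have hF : F ⁻¹' Metric.ball 0 1 ∈ 𝓝 (0 : StrongDual ℂ A) :=
    F.continuous.continuousAt.preimage_mem_nhds (by simpa using Metric.ball_mem_nhds _ one_pos)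
  obtain ⟨B, hB, V, hV, h⟩ := exists_of_mem_nhds
    (e := ContinuousLinearMap.id ℂ (StrongDual ℂ A)) IsInducing.id hF
  obtain ⟨ε, hε, hεV⟩ := Metric.mem_nhds_iff.1 hV
  have hball' : p.ball 0 (r * (ε / 2)) ∈ 𝓝 (0 : A) :=
    (PolynormableSpace.withSeminorms ℂ A).hasBasis_zero_ball.mem_of_mem
      (i := (s, r * (ε / 2))) (mul_pos hr (half_pos hε))
  have hW : ∀ᶠ a in 𝓝 (0 : A), MapsTo (mulLL a) B (p.ball 0 (r * (ε / 2))) := by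
    have ht : Filter.Tendsto (mulLL (A := A)) (𝓝 0) (𝓝 0) := by
      simpa using (mulLL (A := A)).continuous.tendsto 0
    exact ht.eventually (ContinuousLinearMap.eventually_nhds_zero_mapsTo hB hball')
  refine isWAP_of_subset hW hK ?_
  rintro _ ⟨a, ha, rfl⟩
  refine mem_closure_of_bipolar ((p.convex_ball 0 r).linear_image (Φ.restrictScalars ℝ)) ?_
    ⟨_, 0, mem_of_mem_nhds hball, rfl⟩ hK fun x hx => ?_
  · rintro c hc0 _ ⟨_, ⟨b, hb, rfl⟩, rfl⟩
    exact ⟨c • b, p.balanced_ball_zero r c hc0 ⟨b, hb, rfl⟩, map_smul Φ c b⟩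
  · have hm : dualR (x * a) f ∈ F ⁻¹' Metric.ball 0 1 := by
      refine h _ fun b hb => hεV ?_
      have hab : p (a * b) < r * (ε / 2) := Seminorm.mem_ball_zero _ |>.1 (ha hb)
      have hε2 : ((ε / 2 : ℝ) : ℂ) ≠ 0 := by exact_mod_cast (half_pos hε).ne'
      have hmem : (((ε / 2 : ℝ) : ℂ)⁻¹ • (a * b)) ∈ p.ball 0 r := by
        rw [Seminorm.mem_ball_zero, map_smul_eq_mul, norm_inv, Complex.norm_real,
          Real.norm_of_nonneg (half_pos hε).le, inv_mul_lt_iff₀ (half_pos hε), mul_comm]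
        exact hab
      have hfx := hx _ ⟨_, hmem, rfl⟩
      have e : f (x * a * b) = ((ε / 2 : ℝ) : ℂ) * Φ (((ε / 2 : ℝ) : ℂ)⁻¹ • (a * b)) x := by
        rw [map_smul, smul_apply, smul_eq_mul, mul_inv_cancel_left₀ hε2,
          mul_assoc]
        rfl
      rw [mem_ball_zero_iff]
      change ‖f (x * a * b)‖ < ε
      rw [e, norm_mul, Complex.norm_real, Real.norm_of_nonneg (half_pos hε).le]
      have : ε / 2 * ‖Φ (((ε / 2 : ℝ) : ℂ)⁻¹ • (a * b)) x‖ ≤ ε / 2 * 1 :=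
        mul_le_mul_of_nonneg_left hfx (half_pos hε).le
      linarith
    have := mem_ball_zero_iff.1 hm
    exact this.le

variable [PolynormableSpace ℂ A]

/-- `f ↦ F · f`, where `(F · f) a = F (f · a)` for `F ∈ WAP(A)*` and `f ∈ WAP(A)`, as a map into
the dual of `A`. -/
def wapDualLAux (F : StrongDual ℂ (WAPSpace A)) : WAPSpace A →ₗ[ℂ] StrongDual ℂ A where
  toFun f :=
    { toFun := fun a => F (wapR a f)
      map_add' := fun a b => by
        rw [← map_add]; congr 1; apply wapIncl_injective; ext c; simp [add_mul]
      map_smul' := fun t a => by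
        rw [RingHom.id_apply, ← map_smul]; congr 1; apply wapIncl_injective; ext c
        simp [smul_mul_assoc]
      cont := F.continuous.comp (isInducing_wapIncl.continuous_iff.2
        (continuous_dualR (wapIncl A f))) }
  map_add' f g := by
    ext a
    have : wapR a (f + g) = wapR a f + wapR a g := by apply wapIncl_injective; simp
    simp [this]
  map_smul' t f := by
    ext a
    have : wapR a (t • f) = t • wapR a f := by apply wapIncl_injective; simp
    simp [this]

lemma wapDualLAux_mem (F : StrongDual ℂ (WAPSpace A)) (f : WAPSpace A) :
    IsWAP (wapDualLAux F f) := by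
  obtain ⟨G, hG⟩ := exists_extension F
  have : wapDualLAux F f = bidualL G (wapIncl A f) := by
    ext a
    exact (hG (wapR a f)).symm
  rw [this]
  exact isWAP_bidualL (wapIncl_mem f) G

/-- `f ↦ F · f` as a continuous linear map of `WAP(A)` into itself. -/
def wapDualL (F : StrongDual ℂ (WAPSpace A)) : WAPSpace A →L[ℂ] WAPSpace A where
  toFun f := WAPSpace.mk (wapDualLAux F f) (wapDualLAux_mem F f)
  map_add' f g := wapIncl_injective (map_add (wapDualLAux F) f g)
  map_smul' t f := wapIncl_injective (map_smul (wapDualLAux F) t f)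
  cont := isInducing_wapIncl.continuous_iff.2
    (continuous_slice (wapIncl A) isInducing_wapIncl (fun a b => a * b)
      (fun _ _ => isVonNBounded_mul) wapR (fun _ _ _ => rfl) F
      (wapDualLAux F) fun _ _ => rfl)

lemma wapDualL_apply (F : StrongDual ℂ (WAPSpace A)) (f : WAPSpace A) (a : A) :
    wapIncl A (wapDualL F f) a = F (wapR a f) := rfl

/-- `f ↦ f · F`, where `(f · F) a = F (a · f)` for `F ∈ WAP(A)*` and `f ∈ WAP(A)`, as a map into
the dual of `A`. -/
def wapDualRAux (F : StrongDual ℂ (WAPSpace A)) : WAPSpace A →ₗ[ℂ] StrongDual ℂ A where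
  toFun f :=
    { toFun := fun a => F (wapL a f)
      map_add' := fun a b => by
        rw [← map_add]; congr 1; apply wapIncl_injective; ext c; simp [mul_add]
      map_smul' := fun t a => by
        rw [RingHom.id_apply, ← map_smul]; congr 1; apply wapIncl_injective; ext c
        simp [mul_smul_comm]
      cont := F.continuous.comp (isInducing_wapIncl.continuous_iff.2
        (continuous_dualL (wapIncl A f))) }
  map_add' f g := by
    ext a
    have : wapL a (f + g) = wapL a f + wapL a g := by apply wapIncl_injective; simp
    simp [this]
  map_smul' t f := by
    ext a
    have : wapL a (t • f) = t • wapL a f := by apply wapIncl_injective; simp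
    simp [this]

lemma wapDualRAux_mem (F : StrongDual ℂ (WAPSpace A)) (f : WAPSpace A) :
    IsWAP (wapDualRAux F f) := by
  obtain ⟨G, hG⟩ := exists_extension F
  have : wapDualRAux F f = bidualR G (wapIncl A f) := by
    ext a
    exact (hG (wapL a f)).symm
  rw [this]
  exact isWAP_bidualR (wapIncl_mem f) G

/-- `f ↦ f · F` as a continuous linear map of `WAP(A)` into itself. -/
def wapDualR (F : StrongDual ℂ (WAPSpace A)) : WAPSpace A →L[ℂ] WAPSpace A where
  toFun f := WAPSpace.mk (wapDualRAux F f) (wapDualRAux_mem F f)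
  map_add' f g := wapIncl_injective (map_add (wapDualRAux F) f g)
  map_smul' t f := wapIncl_injective (map_smul (wapDualRAux F) t f)
  cont := isInducing_wapIncl.continuous_iff.2
    (continuous_slice (wapIncl A) isInducing_wapIncl (fun a b => b * a)
      (fun _ _ => isVonNBounded_mul_swap) wapL (fun _ _ _ => rfl) F
      (wapDualRAux F) fun _ _ => rfl)

lemma wapDualR_apply (F : StrongDual ℂ (WAPSpace A)) (f : WAPSpace A) (a : A) :
    wapIncl A (wapDualR F f) a = F (wapL a f) := rfl

/-- The convolution product `F ∗ G`, where `(F ∗ G) f = F (G · f)`. -/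
def convolution (F G : StrongDual ℂ (WAPSpace A)) : StrongDual ℂ (WAPSpace A) := F.comp (wapDualL G)

/-- The evolution product `F ∘ G`, where `(F ∘ G) f = G (f · F)`. -/
def evolution (F G : StrongDual ℂ (WAPSpace A)) : StrongDual ℂ (WAPSpace A) := G.comp (wapDualR F)

@[simp] lemma convolution_apply (F G : StrongDual ℂ (WAPSpace A)) (f : WAPSpace A) :
    convolution F G f = F (wapDualL G f) := rfl

@[simp] lemma evolution_apply (F G : StrongDual ℂ (WAPSpace A)) (f : WAPSpace A) :
    evolution F G f = G (wapDualR F f) := rfl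

end Introverted

/-! ### The algebra `WAP(A)*` -/

section WAPDualAlgebra

variable (A : Type*) [NonUnitalRing A] [Module ℂ A] [IsScalarTower ℂ A A]
  [SMulCommClass ℂ A A] [TopologicalSpace A] [IsTopologicalAddGroup A] [ContinuousSMul ℂ A]
  [ContinuousMul A] [PolynormableSpace ℂ A]

/-- `WAP(A)*` (strong topology), as an algebra under the convolution product `∗`. -/
def WAPDualConv : Type _ := StrongDual ℂ (WAPSpace A)

/-- `WAP(A)*` (strong topology), as an algebra under the evolution product `∘`. -/
def WAPDualEvol : Type _ := StrongDual ℂ (WAPSpace A)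

instance : AddCommGroup (WAPDualConv A) :=
  inferInstanceAs (AddCommGroup (StrongDual ℂ (WAPSpace A)))

instance : Module ℂ (WAPDualConv A) :=
  inferInstanceAs (Module ℂ (StrongDual ℂ (WAPSpace A)))

instance : TopologicalSpace (WAPDualConv A) :=
  inferInstanceAs (TopologicalSpace (StrongDual ℂ (WAPSpace A)))

instance : AddCommGroup (WAPDualEvol A) :=
  inferInstanceAs (AddCommGroup (StrongDual ℂ (WAPSpace A)))

instance : Module ℂ (WAPDualEvol A) :=
  inferInstanceAs (Module ℂ (StrongDual ℂ (WAPSpace A)))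

instance : TopologicalSpace (WAPDualEvol A) :=
  inferInstanceAs (TopologicalSpace (StrongDual ℂ (WAPSpace A)))

variable {A}

lemma convolution_add (F G H : StrongDual ℂ (WAPSpace A)) : convolution F (G + H) = convolution F G + convolution F H := by
  ext f
  have : wapDualL (G + H) f = wapDualL G f + wapDualL H f := rfl
  simp [this]

lemma convolution_smul (c : ℂ) (F G : StrongDual ℂ (WAPSpace A)) : convolution F (c • G) = c • convolution F G := by
  ext f
  have : wapDualL (c • G) f = c • wapDualL G f := rfl
  simp [this]

lemma evolution_add_left (F G H : StrongDual ℂ (WAPSpace A)) :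
    evolution (F + G) H = evolution F H + evolution G H := by
  ext f
  have : wapDualR (F + G) f = wapDualR F f + wapDualR G f := rfl
  simp [this]

lemma evolution_smul_left (c : ℂ) (F G : StrongDual ℂ (WAPSpace A)) :
    evolution (c • F) G = c • evolution F G := by
  ext f
  have : wapDualR (c • F) f = c • wapDualR F f := rfl
  simp [this]

lemma convolution_zero (F : StrongDual ℂ (WAPSpace A)) : convolution F 0 = 0 := by
  ext f
  have : wapDualL 0 f = 0 := rfl
  simp [this]

lemma zero_evolution (F : StrongDual ℂ (WAPSpace A)) : evolution 0 F = 0 := by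
  ext f
  have : wapDualR 0 f = 0 := rfl
  simp [this]

lemma convolution_assoc (F G H : StrongDual ℂ (WAPSpace A)) :
    convolution (convolution F G) H = convolution F (convolution G H) := by
  ext f
  refine congrArg F (wapIncl_injective ?_)
  ext a
  refine congrArg G (wapIncl_injective ?_)
  ext b
  refine congrArg H (wapIncl_injective ?_)
  ext c
  simp [mul_assoc]

lemma evolution_assoc (F G H : StrongDual ℂ (WAPSpace A)) :
    evolution (evolution F G) H = evolution F (evolution G H) := by
  ext f
  refine congrArg H (wapIncl_injective ?_)
  ext a
  refine congrArg G (wapIncl_injective ?_)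
  ext b
  refine congrArg F (wapIncl_injective ?_)
  ext c
  simp [mul_assoc]

instance : NonUnitalRing (WAPDualConv A) :=
  { (inferInstance : AddCommGroup (WAPDualConv A)) with
    mul := convolution (A := A)
    left_distrib := convolution_add (A := A)
    right_distrib := fun _ _ _ => rfl
    zero_mul := fun _ => rfl
    mul_zero := convolution_zero (A := A)
    mul_assoc := convolution_assoc (A := A) }

instance : NonUnitalRing (WAPDualEvol A) :=
  { (inferInstance : AddCommGroup (WAPDualEvol A)) with
    mul := evolution (A := A)
    left_distrib := fun _ _ _ => rfl
    right_distrib := evolution_add_left (A := A)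
    zero_mul := zero_evolution (A := A)
    mul_zero := fun _ => rfl
    mul_assoc := evolution_assoc (A := A) }

instance : IsScalarTower ℂ (WAPDualConv A) (WAPDualConv A) := ⟨fun _ _ _ => rfl⟩

instance : SMulCommClass ℂ (WAPDualConv A) (WAPDualConv A) := ⟨fun c F G => (convolution_smul c F G).symm⟩

instance : IsScalarTower ℂ (WAPDualEvol A) (WAPDualEvol A) :=
  ⟨fun c F G => evolution_smul_left c F G⟩

instance : SMulCommClass ℂ (WAPDualEvol A) (WAPDualEvol A) := ⟨fun _ _ _ => rfl⟩

instance : SeparatelyContinuousMul (WAPDualConv A) where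
  continuous_const_mul {F} :=
    continuous_prod (wapIncl A) isInducing_wapIncl (fun a b => a * b)
      (fun _ _ => isVonNBounded_mul) wapR (fun _ _ _ => rfl) F
      (fun G f => wapDualL G f) (fun _ _ _ => rfl)
      { toFun := convolution F, map_add' := convolution_add F, map_smul' := fun c G => convolution_smul c F G }
      fun _ _ => rfl
  continuous_mul_const {G} := (ContinuousLinearMap.precomp ℂ (wapDualL G)).continuous

instance : SeparatelyContinuousMul (WAPDualEvol A) where
  continuous_const_mul {F} := (ContinuousLinearMap.precomp ℂ (wapDualR F)).continuous
  continuous_mul_const {G} :=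
    continuous_prod (wapIncl A) isInducing_wapIncl (fun a b => b * a)
      (fun _ _ => isVonNBounded_mul_swap) wapL (fun _ _ _ => rfl) G
      (fun F f => wapDualR F f) (fun _ _ _ => rfl)
      { toFun := fun F => evolution F G
        map_add' := fun F H => evolution_add_left F H G
        map_smul' := fun c F => evolution_smul_left c F G }
      fun _ _ => rfl

end WAPDualAlgebra

/-! ### `WAP(A)**` as a subspace of `A***` -/

section Embedding

variable (A : Type*) [NonUnitalRing A] [Module ℂ A] [IsScalarTower ℂ A A]
  [SMulCommClass ℂ A A] [TopologicalSpace A] [IsTopologicalAddGroup A] [ContinuousSMul ℂ A]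
  [ContinuousMul A] [PolynormableSpace ℂ A]

/-- The restriction map `A** → WAP(A)*`, `F ↦ F|_WAP(A)`. -/
def restrictBox : BidualBox A →L[ℂ] WAPDualConv A where
  toFun F := ContinuousLinearMap.precomp ℂ (wapIncl A) F
  map_add' _ _ := rfl
  map_smul' _ _ := rfl
  cont := (ContinuousLinearMap.precomp ℂ (wapIncl A)).continuous

lemma restrictBox_surjective : Function.Surjective (restrictBox A) := fun F => by
  obtain ⟨G, hG⟩ := exists_extension F
  exact ⟨G, ContinuousLinearMap.ext hG⟩

/-- The canonical embedding `WAP(A)** → A***`: the transpose of the restriction map. -/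
def wapBidualBoxEmbedding : StrongDual ℂ (WAPDualConv A) →L[ℂ] StrongDual ℂ (BidualBox A) :=
  ContinuousLinearMap.precomp ℂ (restrictBox A)

lemma wapBidualBoxEmbedding_injective : Function.Injective (wapBidualBoxEmbedding A) :=
  fun Φ Ψ h => ContinuousLinearMap.ext fun F => by
    obtain ⟨G, rfl⟩ := restrictBox_surjective A F
    exact DFunLike.congr_fun h G

/-- `WAP(A)**` as a subspace of `A***`. -/
def WAPBidualBox : Submodule ℂ (StrongDual ℂ (BidualBox A)) :=
  LinearMap.range (wapBidualBoxEmbedding A).toLinearMap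

/-- The restriction map `A** → WAP(A)*`, `F ↦ F|_WAP(A)`, the bidual being equipped with `◇`. -/
def restrictDiamond : BidualDiamond A →L[ℂ] WAPDualEvol A where
  toFun F := ContinuousLinearMap.precomp ℂ (wapIncl A) F
  map_add' _ _ := rfl
  map_smul' _ _ := rfl
  cont := (ContinuousLinearMap.precomp ℂ (wapIncl A)).continuous

lemma restrictDiamond_surjective : Function.Surjective (restrictDiamond A) := fun F => by
  obtain ⟨G, hG⟩ := exists_extension F
  exact ⟨G, ContinuousLinearMap.ext hG⟩

/-- The canonical embedding `WAP(A)** → A***`: the transpose of the restriction map. -/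
def wapBidualDiamondEmbedding : StrongDual ℂ (WAPDualEvol A) →L[ℂ] StrongDual ℂ (BidualDiamond A) :=
  ContinuousLinearMap.precomp ℂ (restrictDiamond A)

lemma wapBidualDiamondEmbedding_injective : Function.Injective (wapBidualDiamondEmbedding A) :=
  fun Φ Ψ h => ContinuousLinearMap.ext fun F => by
    obtain ⟨G, rfl⟩ := restrictDiamond_surjective A F
    exact DFunLike.congr_fun h G

/-- `WAP(A)**` as a subspace of `A***`, the bidual being equipped with `◇`. -/
def WAPBidualDiamond : Submodule ℂ (StrongDual ℂ (BidualDiamond A)) :=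
  LinearMap.range (wapBidualDiamondEmbedding A).toLinearMap

end Embedding

end ArensReg

end

namespace ArensReg

/-! The engine is a transfer principle. A continuous homomorphism `φ : C → B` pulls weakly almost
periodic functionals on `B` back to weakly almost periodic functionals on `C` (`isWAP_comp`),
because its transpose intertwines the module actions and preserves weak compactness. So regularity
of `B` passes to `C` as soon as every continuous functional on `C` factors through `φ`
(`ArensRegular.of_comp`).

Two applications give the theorem. The canonical map of `A` into `A**` is multiplicative for both
Arens products, and `f ∈ A*` is its composite with evaluation at `f`; hence regularity of `A**`
forces that of `A`. This is where the Fréchet hypothesis enters: `A` is barrelled, which makes the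
canonical map continuous for the strong topology on `A**`.

Once `A` is regular, `WAP(A)` is `A*` with the same topology, so restriction `A** → WAP(A)*` is a
topological isomorphism of algebras. Therefore `A**` and `WAP(A)*` are regular together, and
`WAP(A)**` fills all of `A***`, so that the equality in (iii) just says that `A**` is regular. -/

lemma isWAP_comp {B C : Type*}
    [NonUnitalRing B] [Module ℂ B] [IsScalarTower ℂ B B] [SMulCommClass ℂ B B]
    [TopologicalSpace B] [SeparatelyContinuousMul B]
    [NonUnitalRing C] [Module ℂ C] [IsScalarTower ℂ C C] [SMulCommClass ℂ C C]
    [TopologicalSpace C] [SeparatelyContinuousMul C]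
    (φ : C →L[ℂ] B) (hφ : ∀ a b, φ (a * b) = φ a * φ b) {g : StrongDual ℂ B} (hg : IsWAP g) :
    IsWAP (g.comp φ) := by
  obtain ⟨U, hU, hc⟩ := hg
  -- The transpose of `φ` is strongly continuous, hence weak-to-weak continuous, so it carries the
  -- compact closure of the orbit of `g` to a weakly compact set.
  refine isWAP_of_subset (U := φ ⁻¹' U)
    (φ.continuous.continuousAt.preimage_mem_nhds (by simpa using hU))
    (hc.image (WeakSpace.map (ContinuousLinearMap.precomp ℂ φ :
      StrongDual ℂ B →L[ℂ] StrongDual ℂ C)).continuous) ?_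
  rintro _ ⟨a, ha, rfl⟩
  -- Intertwining: `a · (g ∘ φ)` is the image of `φ a · g` under the transpose of `φ`, by
  -- multiplicativity at the pair `(b, a)`.
  refine ⟨_, subset_closure ⟨φ a, ha, rfl⟩,
    congrArg (toWeakSpace ℂ (StrongDual ℂ C)) (ContinuousLinearMap.ext fun b => ?_)⟩
  exact congrArg g (hφ b a).symm

/-- Only surjectivity of the transpose matters; `φ` itself may be neither injective nor onto. In the
applications the required `g` is explicit: an evaluation, or a composite with an inverse of `φ`. -/
lemma ArensRegular.of_comp {B C : Type*}
    [NonUnitalRing B] [Module ℂ B] [IsScalarTower ℂ B B] [SMulCommClass ℂ B B]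
    [TopologicalSpace B] [SeparatelyContinuousMul B]
    [NonUnitalRing C] [Module ℂ C] [IsScalarTower ℂ C C] [SMulCommClass ℂ C C]
    [TopologicalSpace C] [SeparatelyContinuousMul C]
    (hB : ArensRegular B) (φ : C →L[ℂ] B) (hφ : ∀ a b, φ (a * b) = φ a * φ b)
    (hsurj : ∀ f : StrongDual ℂ C, ∃ g : StrongDual ℂ B, g.comp φ = f) : ArensRegular C := by
  refine eq_top_iff.2 fun f _ => ?_
  obtain ⟨g, rfl⟩ := hsurj f
  exact isWAP_comp φ hφ (mem_WAP.1 (hB ▸ Submodule.mem_top))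

noncomputable section

/-- Evaluation at a point, as an element of the bidual. -/
def bidualEval {E : Type*} [AddCommGroup E] [Module ℂ E] [TopologicalSpace E] [ContinuousSMul ℂ E]
    (x : E) : StrongDual ℂ (StrongDual ℂ E) where
  toFun f := f x
  map_add' _ _ := rfl
  map_smul' _ _ := rfl
  cont := continuous_eval_const x

/-! ### The canonical map of a barrelled space into its strong bidual -/

section Barrelled

variable (E : Type*) [AddCommGroup E] [Module ℂ E] [UniformSpace E] [IsUniformAddGroup E]
  [ContinuousSMul ℂ E]

/-- `bidualEval` as a linear map. -/
def bidualInclLin : E →ₗ[ℂ] StrongDual ℂ (StrongDual ℂ E) where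
  toFun := bidualEval
  map_add' a b := by ext f; exact map_add f a b
  map_smul' c a := by ext f; exact map_smul f c a

variable [BarrelledSpace ℂ E]

set_option maxSynthPendingDepth 5 in
-- A basic zero neighbourhood of the strong bidual asks for smallness uniformly on a strongly
-- bounded set `S` of functionals. In a barrelled space such an `S` is equicontinuous, so
-- evaluations at points near zero are uniformly small on it.
lemma continuous_bidualInclLin : Continuous (bidualInclLin E) := by
  refine continuous_of_continuousAt_zero (bidualInclLin E) ?_
  rw [ContinuousAt, map_zero]
  refine ContinuousLinearMap.hasBasis_nhds_zero.tendsto_right_iff.2 ?_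
  rintro ⟨S, V⟩ ⟨hS, hV⟩
  have heq : UniformEquicontinuous fun f : S => ((f : StrongDual ℂ E) : E → ℂ) := by
    refine (norm_withSeminorms ℂ ℂ).banach_steinhaus
      (𝓕 := fun f : S => (f : StrongDual ℂ E)) fun _ x => ?_
    -- Banach–Steinhaus needs only pointwise boundedness: strong boundedness tested on a single
    -- point.
    have hb := ContinuousLinearMap.isVonNBounded_iff.1 hS {x} (isVonNBounded_singleton x)
    obtain ⟨r, hr⟩ := (NormedSpace.isVonNBounded_iff ℂ).1 hb |>.exists_norm_le
    refine ⟨r, ?_⟩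
    rintro _ ⟨f, rfl⟩
    exact hr _ ⟨f, f.2, x, rfl, rfl⟩
  obtain ⟨ε, hε, hεV⟩ := Metric.mem_nhds_iff.1 hV
  -- Since every `f` in `S` vanishes at zero, equicontinuity there gives one neighbourhood on which
  -- all of them stay below `ε`.
  have h0 := (heq.equicontinuous 0) _ (Metric.dist_mem_uniformity hε)
  filter_upwards [h0] with a ha f hf
  refine hεV ?_
  have hfa : ‖f a‖ < ε := by simpa using ha ⟨f, hf⟩
  exact mem_ball_zero_iff.2 hfa

/-- The canonical map of a barrelled space into its strong bidual. -/
def bidualIncl : E →L[ℂ] StrongDual ℂ (StrongDual ℂ E) where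
  toLinearMap := bidualInclLin E
  cont := continuous_bidualInclLin E

end Barrelled

/-! ### Restriction to weakly almost periodic functionals and its inverse -/

section Restrict

variable {A : Type*} [NonUnitalRing A] [Module ℂ A] [IsScalarTower ℂ A A]
  [SMulCommClass ℂ A A] [TopologicalSpace A] [IsTopologicalAddGroup A] [ContinuousSMul ℂ A]
  [ContinuousMul A] [PolynormableSpace ℂ A]

/-- For `f` in `WAP(A)`, both `f · a` and `G · f` stay in `WAP(A)`, so the value of the product at
`f` involves only the restrictions of `F` and `G`. -/
lemma restrictBox_mul (F G : BidualBox A) :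
    restrictBox A (F * G) = restrictBox A F * restrictBox A G := rfl

lemma restrictDiamond_mul (F G : BidualDiamond A) :
    restrictDiamond A (F * G) = restrictDiamond A F * restrictDiamond A G := rfl

/-- For an Arens regular algebra, every functional is weakly almost periodic. -/
def ArensRegular.toWAPSpace (h : ArensRegular A) : StrongDual ℂ A →L[ℂ] WAPSpace A where
  toFun f := WAPSpace.mk f (mem_WAP.1 (h ▸ Submodule.mem_top))
  map_add' _ _ := rfl
  map_smul' _ _ := rfl
  cont := isInducing_wapIncl.continuous_iff.2 continuous_id

/-- For an Arens regular algebra, the inverse of the restriction map `A** → WAP(A)*`. -/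
def ArensRegular.extendBox (h : ArensRegular A) : WAPDualConv A →L[ℂ] BidualBox A where
  toFun F := ContinuousLinearMap.precomp ℂ h.toWAPSpace F
  map_add' _ _ := rfl
  map_smul' _ _ := rfl
  cont := (ContinuousLinearMap.precomp ℂ h.toWAPSpace).continuous

/-- For an Arens regular algebra, the inverse of the restriction map `A** → WAP(A)*`. -/
def ArensRegular.extendDiamond (h : ArensRegular A) : WAPDualEvol A →L[ℂ] BidualDiamond A where
  toFun F := ContinuousLinearMap.precomp ℂ h.toWAPSpace F
  map_add' _ _ := rfl
  map_smul' _ _ := rfl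
  cont := (ContinuousLinearMap.precomp ℂ h.toWAPSpace).continuous

lemma ArensRegular.extendBox_mul (h : ArensRegular A) (F G : WAPDualConv A) :
    h.extendBox (F * G) = h.extendBox F * h.extendBox G := rfl

lemma ArensRegular.extendDiamond_mul (h : ArensRegular A) (F G : WAPDualEvol A) :
    h.extendDiamond (F * G) = h.extendDiamond F * h.extendDiamond G := rfl

/-- Extending after restricting is the identity of `A**`, so any `Φ` in `A***` is the transpose of
restriction applied to `Φ ∘ h.extendBox`. -/
lemma ArensRegular.wapBidualBox_eq_top (h : ArensRegular A) : WAPBidualBox A = ⊤ :=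
  eq_top_iff.2 fun Φ _ => ⟨Φ.comp h.extendBox, rfl⟩

lemma ArensRegular.wapBidualDiamond_eq_top (h : ArensRegular A) : WAPBidualDiamond A = ⊤ :=
  eq_top_iff.2 fun Φ _ => ⟨Φ.comp h.extendDiamond, rfl⟩

/-- Restriction and extension are mutually inverse continuous homomorphisms. The transfer principle
applies to each, a functional being factored through one by composing it with the other. -/
lemma ArensRegular.wapDualConv_iff (h : ArensRegular A) :
    ArensRegular (WAPDualConv A) ↔ ArensRegular (BidualBox A) :=
  ⟨fun hW => hW.of_comp (restrictBox A) restrictBox_mul fun Φ => ⟨Φ.comp h.extendBox, rfl⟩,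
    fun hB => hB.of_comp h.extendBox h.extendBox_mul fun Φ => ⟨Φ.comp (restrictBox A), rfl⟩⟩

lemma ArensRegular.wapDualEvol_iff (h : ArensRegular A) :
    ArensRegular (WAPDualEvol A) ↔ ArensRegular (BidualDiamond A) :=
  ⟨fun hW => hW.of_comp (restrictDiamond A) restrictDiamond_mul
      fun Φ => ⟨Φ.comp h.extendDiamond, rfl⟩,
    fun hB => hB.of_comp h.extendDiamond h.extendDiamond_mul
      fun Φ => ⟨Φ.comp (restrictDiamond A), rfl⟩⟩

end Restrict

/-! ### Descent of regularity from the bidual of a Fréchet algebra -/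

section Bidual

variable {A : Type*} [NonUnitalRing A] [Module ℂ A] [IsScalarTower ℂ A A]
  [SMulCommClass ℂ A A] [UniformSpace A] [FrechetAlgebra A]

/-- Countably many seminorms give a countably generated uniformity; with completeness, Baire's
theorem applies, and a Baire space is barrelled. -/
instance FrechetAlgebra.toBarrelledSpace : BarrelledSpace ℂ A := by
  obtain ⟨p, hp, -, -⟩ := FrechetAlgebra.exists_seminorms (A := A)
  have := hp.firstCountableTopology
  have := IsUniformAddGroup.uniformity_countably_generated (α := A)
  infer_instance

/-- Unfolding `□` on evaluations at `a` and `b` gives `f ↦ f (a * b)`, so the canonical map is a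
homomorphism; the same holds for `◇`. -/
lemma ArensRegular.of_bidualBox (h : ArensRegular (BidualBox A)) : ArensRegular A :=
  h.of_comp (C := A) (show A →L[ℂ] BidualBox A from bidualIncl A) (fun _ _ => rfl)
    -- Here `bidualEval` is taken one level up: evaluation at `f` is an element of `A***`
    -- restricting to `f` on `A`.
    fun f => ⟨bidualEval f, rfl⟩

lemma ArensRegular.of_bidualDiamond (h : ArensRegular (BidualDiamond A)) : ArensRegular A :=
  h.of_comp (C := A) (show A →L[ℂ] BidualDiamond A from bidualIncl A) (fun _ _ => rfl)
    fun f => ⟨bidualEval f, rfl⟩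

end Bidual

end

end ArensReg

theorem mainTheorem5 (A : Type*) [NonUnitalRing A] [Module ℂ A] [IsScalarTower ℂ A A]
    [SMulCommClass ℂ A A] [UniformSpace A] [ArensReg.FrechetAlgebra A] :
    List.TFAE
      [ArensReg.ArensRegular (ArensReg.BidualBox A),
        ArensReg.ArensRegular A ∧ ArensReg.ArensRegular (ArensReg.WAPDualConv A),
        ArensReg.ArensRegular A ∧
          ArensReg.WAPBidualBox A = ArensReg.WAP (ArensReg.BidualBox A)] ∧
    List.TFAE
      [ArensReg.ArensRegular (ArensReg.BidualDiamond A),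
        ArensReg.ArensRegular A ∧ ArensReg.ArensRegular (ArensReg.WAPDualEvol A),
        ArensReg.ArensRegular A ∧
          ArensReg.WAPBidualDiamond A = ArensReg.WAP (ArensReg.BidualDiamond A)] := by
  constructor
  · tfae_have 1 → 2 := fun h => ⟨h.of_bidualBox, h.of_bidualBox.wapDualConv_iff.2 h⟩
    -- Both subspaces are all of `A***`.
    tfae_have 2 → 3 := fun h =>
      ⟨h.1, h.1.wapBidualBox_eq_top.trans (h.1.wapDualConv_iff.1 h.2).symm⟩
    -- Regularity of `A` makes `WAP(A)**` the whole of `A***`, so the assumed equality is regularity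
    -- of `A**`.
    tfae_have 3 → 1 := fun h => h.2.symm.trans h.1.wapBidualBox_eq_top
    tfae_finish
  · tfae_have 1 → 2 := fun h => ⟨h.of_bidualDiamond, h.of_bidualDiamond.wapDualEvol_iff.2 h⟩
    tfae_have 2 → 3 := fun h =>
      ⟨h.1, h.1.wapBidualDiamond_eq_top.trans (h.1.wapDualEvol_iff.1 h.2).symm⟩
    tfae_have 3 → 1 := fun h => h.2.symm.trans h.1.wapBidualDiamond_eq_top
    tfae_finish
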